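/- Let $m\ge 1$. For a convex set $C\subset\mathbb R^m$ and $x\in C$ let $N_C(x)=\{u\in\mathbb R^m : \langle u,y-x\rangle\le 0 \text{ for all } y\in C\}$ be the normal cone of $C$ at $x$, let $\mathcal N_C$ be the set consisting of all $N_C(x)$, $x\in C$, and of $\mathbb R^m$, and call $N\in\mathcal N_C$ a proper normal cone if $N\ne\mathbb R^m$ and $N$ is not the normal cone of $C$ at a relative interior point of $C$. An exposed face of $C$ is the empty set or the set of maximizers over $C$ of a linear form. The class $\mathcal C_m'$ consists of all convex sets $C\subset\mathbb R^m$ that have interior points and an exposed face other than $\emptyset$ and $C$, and are such that every extreme ray (face which is a ray) of every proper normal cone of $C$ belongs to $\mathcal N_C$. Let $K\subset\mathbb R^m$ be a compact convex set with $0$ in its interior, and let $K^\circ=\{u\in\mathbb R^m : \langle u,x\rangle\le 1 \text{ for all } x\in K\}$ be its polar. (1) If there is a convex set $C\subset\mathbb R^m$ with interior points which is strictly convex (the relative interior of every non-degenerate closed segment in $C$ lies in the interior of $C$), such that every extreme point of $K^\circ$ belongs to $C$ and lies on the boundary of $C$, then $K\in\mathcal C_m'$. (2) In particular this applies to coorbitopes: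 if $K=O^\circ$ where $O\subset\mathbb R^m$ is an orbitope, that is, the convex hull of an orbit of a compact group acting linearly and continuously on $\mathbb R^m$ (for example, a compact real algebraic group with an algebraic linear action), then a set $C$ as in (1) exists, and $K\in\mathcal C_m'$. -/

import Mathlib

universe u

/-- The normal cone of `C` at the point `x`. -/
def normalConeAt {m : ℕ} (C : Set (EuclideanSpace ℝ (Fin m))) (x : EuclideanSpace ℝ (Fin m)) :
    Set (EuclideanSpace ℝ (Fin m)) :=
  {w | ∀ y ∈ C, inner ℝ w (y - x) ≤ 0}

/-- The set of all normal cones of `C`: those at the points of `C`, and the whole space, which is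
by convention the normal cone of `C` at the empty face. -/
def normalCones {m : ℕ} (C : Set (EuclideanSpace ℝ (Fin m))) :
    Set (Set (EuclideanSpace ℝ (Fin m))) :=
  insert Set.univ (normalConeAt C '' C)

/-- `N` is a proper normal cone of `C`: a normal cone of `C` that is neither the whole space nor
the normal cone of `C` at its improper face `C`, which is the normal cone at any relative
interior point of `C`. -/
def IsProperNormalCone {m : ℕ} (C N : Set (EuclideanSpace ℝ (Fin m))) : Prop :=
  N ∈ normalCones C ∧ N ≠ Set.univ ∧ ∀ x ∈ intrinsicInterior ℝ C, N ≠ normalConeAt C x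

/-- `F` is a face of the convex set `C`: a convex subset of `C` that contains every segment of `C`
whose relative interior it meets. -/
def IsConvexFace {m : ℕ} (C F : Set (EuclideanSpace ℝ (Fin m))) : Prop :=
  Convex ℝ F ∧ IsExtreme ℝ C F

/-- `R` is a ray (closed half-line). -/
def IsRay {m : ℕ} (R : Set (EuclideanSpace ℝ (Fin m))) : Prop :=
  ∃ a v : EuclideanSpace ℝ (Fin m), v ≠ 0 ∧ R = {x | ∃ t : ℝ, 0 ≤ t ∧ x = a + t • v}

/-- `R` is an extreme ray of `N`: a face of `N` that is a ray. -/
def IsExtremeRay {m : ℕ} (N R : Set (EuclideanSpace ℝ (Fin m))) : Prop :=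
  IsConvexFace N R ∧ IsRay R

/-- A proper convex subset of `ℝ^m`: a convex set that has interior points and an exposed face
other than `∅` and itself. -/
def IsProperConvexSubset {m : ℕ} (C : Set (EuclideanSpace ℝ (Fin m))) : Prop :=
  Convex ℝ C ∧ (interior C).Nonempty ∧
    ∃ F : Set (EuclideanSpace ℝ (Fin m)), IsExposed ℝ C F ∧ F ≠ ∅ ∧ F ≠ C

/-- The class `𝒞'_m`: the proper convex subsets `C` of `ℝ^m` such that every extreme ray of every
proper normal cone of `C` is itself a normal cone of `C`. -/
def classCPrime (m : ℕ) : Set (Set (EuclideanSpace ℝ (Fin m))) :=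
  {C | IsProperConvexSubset C ∧
    ∀ N, IsProperNormalCone C N → ∀ R, IsExtremeRay N R → R ∈ normalCones C}

/-- The polar of a set (one-sided: `⟪w, x⟫ ≤ 1`, without absolute value). -/
def convexPolar {m : ℕ} (K : Set (EuclideanSpace ℝ (Fin m))) : Set (EuclideanSpace ℝ (Fin m)) :=
  {w | ∀ x ∈ K, inner ℝ w x ≤ 1}

/-- An orbitope: the convex hull of an orbit of a compact group acting linearly (and continuously)
on `ℝ^m`. Compact real algebraic groups with their algebraic actions are a special case. -/
def IsOrbitope {m : ℕ} (O : Set (EuclideanSpace ℝ (Fin m))) : Prop :=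
  ∃ (G : Type u) (_ : Group G) (_ : TopologicalSpace G) (_ : IsTopologicalGroup G)
    (_ : CompactSpace G) (ρ : Representation ℝ G (EuclideanSpace ℝ (Fin m)))
    (_ : Continuous fun p : G × EuclideanSpace ℝ (Fin m) => ρ p.1 p.2)
    (v : EuclideanSpace ℝ (Fin m)),
    O = convexHull ℝ (Set.range fun g : G => ρ g v)

/-- A coorbitope: the polar of an orbitope. -/
def IsCoorbitope {m : ℕ} (K : Set (EuclideanSpace ℝ (Fin m))) : Prop :=
  ∃ O : Set (EuclideanSpace ℝ (Fin m)), IsOrbitope.{u} O ∧ K = convexPolar O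

/-- All extreme points of `L` lie on the boundary of some strictly convex set `C` with interior
points and belong to `C`. -/
def ExtremePointsOnStrictlyConvexBoundary {m : ℕ} (L : Set (EuclideanSpace ℝ (Fin m))) : Prop :=
  ∃ C : Set (EuclideanSpace ℝ (Fin m)), StrictConvex ℝ C ∧ (interior C).Nonempty ∧
    L.extremePoints ℝ ⊆ C ∩ frontier C

/-!
Throughout, `K` is a compact convex set with `0` in its interior, so that its polar `K°` is
compact and convex and `K°° = K`.

*Reduction to exposed points.* A proper normal cone of `K` is a pointed cone `N = N_K(x) ≠ {0}`, and
an extreme ray of it emanates from `0`. Its generator `v` can be normalized by `⟪v, x⟫ = 1`; then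
`v` is an extreme point of `K°`, because the points `w` of `K°` with `⟪w, x⟫ = 1` form a face of
`K°` lying in `N` (`mem_extremePoints_convexPolar`). On the other hand, the ray spanned by an
*exposed* point `v` of `K°` is a normal cone of `K`, namely at the point `y ∈ K°° = K` that
exposes `v` and has `⟪y, v⟫ = 1` (`normalConeAt_eq_ray`). So it suffices that all extreme
points of `K°` are exposed.

*Extreme points on a strictly convex boundary are exposed.* If `v` lies on the boundary of a
strictly convex set `C`, a supporting hyperplane of `C` at `v` meets `C` in `v` only
(`StrictConvex.exists_inner_lt`). If `C` contains all extreme points of `K°`, then the face of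
`K°` on which the corresponding linear form is maximal has no extreme point but `v`, and by the
Krein-Milman theorem it is `{v}` (`eq_of_forall_extremePoints_inner_lt`).

*Coorbitopes.* If `K = O°` with `O` the convex hull of the orbit of `v`, boundedness of `K` forces
`0 ∈ O`; since `O` is closed (`isCompact_convexHull_of_isCompact`), `K° = O`, and the extreme points
of `O` lie in the orbit. No invariant inner product is needed: with `r = max_g ‖ρ(g) v‖`, the
intersection `C` over all `g` of the ellipsoids `{x | ‖ρ(g) x‖ ≤ r}` is invariant, has the orbit on
its boundary, and is strictly convex, because the points with `‖ρ(g) x‖ < r` for all `g` are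
interior to `C` by compactness of the group (`orbitBall`).
-/

section Polarity

variable {m : ℕ} {K : Set (EuclideanSpace ℝ (Fin m))}

/-! ### Polars -/

lemma exists_pos_smul_mem_of_zero_mem_interior (hK0 : 0 ∈ interior K)
    (y : EuclideanSpace ℝ (Fin m)) : ∃ ε : ℝ, 0 < ε ∧ ε • y ∈ K := by
  have hc : Filter.Tendsto (fun t : ℝ => t • y) (nhdsWithin 0 (Set.Ioi 0)) (nhds 0) := by
    have : Continuous fun t : ℝ => t • y := by fun_prop
    simpa using (this.tendsto 0).mono_left nhdsWithin_le_nhds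
  obtain ⟨ε, h1, h2⟩ := ((hc.eventually (mem_interior_iff_mem_nhds.1 hK0)).and
    self_mem_nhdsWithin).exists
  exact ⟨ε, h2, h1⟩

lemma exists_mem_inner_pos (hK0 : 0 ∈ interior K) {w : EuclideanSpace ℝ (Fin m)} (hw : w ≠ 0) :
    ∃ y ∈ K, 0 < inner ℝ w y := by
  obtain ⟨ε, hε, h⟩ := exists_pos_smul_mem_of_zero_mem_interior hK0 w
  refine ⟨_, h, ?_⟩
  rw [real_inner_smul_right]
  exact mul_pos hε (real_inner_self_pos.2 hw)

lemma convex_convexPolar (K : Set (EuclideanSpace ℝ (Fin m))) : Convex ℝ (convexPolar K) := by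
  intro a ha b hb s t hs ht hst x hx
  rw [inner_add_left, real_inner_smul_left, real_inner_smul_left]
  have h1 := mul_le_mul_of_nonneg_left (ha x hx) hs
  have h2 := mul_le_mul_of_nonneg_left (hb x hx) ht
  linarith

lemma isClosed_convexPolar (K : Set (EuclideanSpace ℝ (Fin m))) : IsClosed (convexPolar K) := by
  have : convexPolar K = ⋂ x ∈ K, {w | inner ℝ w x ≤ 1} := by
    ext w; simp [convexPolar]
  rw [this]
  exact isClosed_biInter fun x _ => isClosed_le (by fun_prop) (by fun_prop)

lemma isCompact_convexPolar (hK0 : 0 ∈ interior K) : IsCompact (convexPolar K) := by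
  refine Metric.isCompact_of_isClosed_isBounded (isClosed_convexPolar K) ?_
  obtain ⟨ε, hε, hb⟩ := Metric.nhds_basis_closedBall.mem_iff.1 (mem_interior_iff_mem_nhds.1 hK0)
  refine (Metric.isBounded_closedBall (x := 0) (r := ε⁻¹)).subset fun w hw => ?_
  rw [mem_closedBall_zero_iff]
  rcases eq_or_ne w 0 with rfl | hw0
  · simpa using hε.le
  have hn : 0 < ‖w‖ := norm_pos_iff.2 hw0
  -- Test `w` against the point of the ball of radius `ε` in its own direction.
  have hmem : (ε / ‖w‖) • w ∈ K := hb (by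
    rw [mem_closedBall_zero_iff, norm_smul, norm_div, norm_norm, Real.norm_of_nonneg hε.le,
      div_mul_cancel₀ _ hn.ne'])
  have h := hw _ hmem
  rw [real_inner_smul_right, real_inner_self_eq_norm_sq] at h
  have : ε / ‖w‖ * ‖w‖ ^ 2 = ε * ‖w‖ := by field_simp
  rw [this] at h
  rwa [le_inv_comm₀ hn hε, ← one_div, le_div_iff₀ hn]

lemma exists_inner_lt_of_notMem (hc : Convex ℝ K) (hcl : IsClosed K)
    {y : EuclideanSpace ℝ (Fin m)} (hy : y ∉ K) :
    ∃ (w : EuclideanSpace ℝ (Fin m)) (u : ℝ), (∀ x ∈ K, inner ℝ w x < u) ∧ u < inner ℝ w y := by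
  obtain ⟨f, u, h1, h2⟩ := geometric_hahn_banach_closed_point hc hcl hy
  refine ⟨(InnerProductSpace.toDual ℝ _).symm f, u, fun x hx => ?_, ?_⟩
  · rw [InnerProductSpace.toDual_symm_apply]; exact h1 x hx
  · rw [InnerProductSpace.toDual_symm_apply]; exact h2

/-- The bipolar theorem. -/
lemma convexPolar_convexPolar (hc : Convex ℝ K) (hcl : IsClosed K) (h0 : 0 ∈ K) :
    convexPolar (convexPolar K) = K := by
  refine Set.Subset.antisymm (fun y hy => ?_) fun x hx w hw => ?_
  · by_contra hyK
    obtain ⟨w, u, h1, h2⟩ := exists_inner_lt_of_notMem hc hcl hyK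
    have hu : 0 < u := by simpa using h1 0 h0
    have hw : u⁻¹ • w ∈ convexPolar K := fun x hx => by
      rw [real_inner_smul_left, inv_mul_le_iff₀ hu, mul_one]
      exact (h1 x hx).le
    have := hy _ hw
    rw [real_inner_smul_right, inv_mul_le_iff₀ hu, mul_one, real_inner_comm] at this
    linarith
  · rw [real_inner_comm]
    exact hw x hx

/-! ### Normal cones -/

lemma inner_pos_of_mem_normalConeAt (hK0 : 0 ∈ interior K) {x w : EuclideanSpace ℝ (Fin m)}
    (hw : w ∈ normalConeAt K x) (hw0 : w ≠ 0) : 0 < inner ℝ w x := by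
  obtain ⟨y, hy, hpos⟩ := exists_mem_inner_pos hK0 hw0
  have := hw y hy
  rw [inner_sub_right] at this
  linarith

lemma smul_mem_normalConeAt {x w : EuclideanSpace ℝ (Fin m)} (hw : w ∈ normalConeAt K x) {t : ℝ}
    (ht : 0 ≤ t) : t • w ∈ normalConeAt K x := fun y hy => by
  rw [real_inner_smul_left]
  exact mul_nonpos_of_nonneg_of_nonpos ht (hw y hy)

lemma mem_convexPolar_of_mem_normalConeAt {x w : EuclideanSpace ℝ (Fin m)}
    (hw : w ∈ normalConeAt K x) (h1 : inner ℝ w x = 1) : w ∈ convexPolar K := fun y hy => by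
  have := hw y hy
  rw [inner_sub_right] at this
  linarith

lemma mem_normalConeAt_of_mem_convexPolar {x w : EuclideanSpace ℝ (Fin m)}
    (hw : w ∈ convexPolar K) (h1 : inner ℝ w x = 1) : w ∈ normalConeAt K x := fun y hy => by
  have := hw y hy
  rw [inner_sub_right]
  linarith

/-- An extreme ray of a normal cone starts at the origin, because normal cones of a set with
interior points contain no line. -/
lemma IsExtremeRay.exists_eq (hK0 : 0 ∈ interior K) {x : EuclideanSpace ℝ (Fin m)}
    {R : Set (EuclideanSpace ℝ (Fin m))} (hR : IsExtremeRay (normalConeAt K x) R) :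
    ∃ v : EuclideanSpace ℝ (Fin m), v ≠ 0 ∧ R = {w | ∃ t : ℝ, 0 ≤ t ∧ w = t • v} := by
  obtain ⟨⟨-, hext⟩, a, v, hv, rfl⟩ := hR
  have haR : a ∈ {w | ∃ t : ℝ, 0 ≤ t ∧ w = a + t • v} := ⟨0, le_rfl, by simp⟩
  have haN := hext.1 haR
  have h0N : (0 : EuclideanSpace ℝ (Fin m)) ∈ normalConeAt K x := fun y _ => by simp
  have h0R : (0 : EuclideanSpace ℝ (Fin m)) ∈ {w | ∃ t : ℝ, 0 ≤ t ∧ w = a + t • v} := by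
    -- The point `a` of the face is the midpoint of `0` and `2 a`, both in the cone.
    refine hext.2 h0N (smul_mem_normalConeAt haN zero_le_two) haR ?_
    exact ⟨1 / 2, 1 / 2, by norm_num, by norm_num, by norm_num, by
      rw [smul_zero, zero_add, smul_smul]; norm_num⟩
  obtain ⟨s, hs, hsa⟩ := h0R
  have ha : a = -(s • v) := eq_neg_of_add_eq_zero_left hsa.symm
  -- Both `a = -s v` and its opposite `s v = a + 2 s v` belong to the cone.
  have hna : -a ∈ normalConeAt K x := hext.1 ⟨2 * s, by positivity, by rw [ha]; module⟩
  have ha0 : a = 0 := by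
    by_contra hne
    have h1 := inner_pos_of_mem_normalConeAt hK0 haN hne
    have h2 := inner_pos_of_mem_normalConeAt hK0 hna (neg_ne_zero.2 hne)
    rw [inner_neg_left] at h2
    linarith
  exact ⟨v, hv, by simp [ha0]⟩

/-- A generator of an extreme ray of a normal cone, normalized to lie on the boundary of the
polar, is an extreme point of the polar. -/
lemma mem_extremePoints_convexPolar {x v : EuclideanSpace ℝ (Fin m)} (hx : x ∈ K)
    (h1 : inner ℝ v x = 1)
    (hR : IsExtreme ℝ (normalConeAt K x) {w | ∃ t : ℝ, 0 ≤ t ∧ w = t • v}) :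
    v ∈ (convexPolar K).extremePoints ℝ := by
  have hvR : v ∈ {w | ∃ t : ℝ, 0 ≤ t ∧ w = t • v} := ⟨1, zero_le_one, by simp⟩
  refine ⟨mem_convexPolar_of_mem_normalConeAt (hR.1 hvR) h1, fun a ha b hb hab => ?_⟩
  obtain ⟨s, t, hs, ht, hst, rfl⟩ := id hab
  have hax := ha x hx
  have hbx := hb x hx
  rw [inner_add_left, real_inner_smul_left, real_inner_smul_left] at h1
  have hax1 : inner ℝ a x = 1 := by
    by_contra hne
    have h2 := mul_lt_mul_of_pos_left (lt_of_le_of_ne hax hne) hs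
    have h3 := mul_le_mul_of_nonneg_left hbx ht.le
    linarith
  have hbx1 : inner ℝ b x = 1 := by
    rw [hax1] at h1
    have : t * inner ℝ b x = t * 1 := by linarith
    exact mul_left_cancel₀ ht.ne' this
  obtain ⟨c, -, hc⟩ := hR.2 (mem_normalConeAt_of_mem_convexPolar ha hax1)
    (mem_normalConeAt_of_mem_convexPolar hb hbx1) hvR hab
  -- Comparing inner products with `x` shows that the scalar `c` is `1`.
  have h4 : inner ℝ a x = c * (s * inner ℝ a x + t * inner ℝ b x) := by
    conv_lhs => rw [hc]
    rw [real_inner_smul_left, inner_add_left, real_inner_smul_left, real_inner_smul_left]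
  have hc1 : c = 1 := by rw [h1, hax1] at h4; linarith
  rwa [hc1, one_smul] at hc

/-- If `y` exposes the point `v` of the polar of `K`, and `y` is normalized by `⟪y, v⟫ = 1`, then
the normal cone of `K` at `y` is the ray spanned by `v`. -/
lemma normalConeAt_eq_ray (hK0 : 0 ∈ interior K) {y v : EuclideanSpace ℝ (Fin m)}
    (hv : v ∈ convexPolar K) (hyv : inner ℝ v y = 1)
    (huniq : ∀ w ∈ convexPolar K, inner ℝ w y = 1 → w = v) :
    normalConeAt K y = {w | ∃ t : ℝ, 0 ≤ t ∧ w = t • v} := by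
  refine Set.Subset.antisymm (fun w hw => ?_) ?_
  · rcases eq_or_ne w 0 with rfl | hw0
    · exact ⟨0, le_rfl, by simp⟩
    have hpos := inner_pos_of_mem_normalConeAt hK0 hw hw0
    have h1 : inner ℝ ((inner ℝ w y)⁻¹ • w) y = 1 := by
      rw [real_inner_smul_left, inv_mul_cancel₀ hpos.ne']
    have := huniq _ (mem_convexPolar_of_mem_normalConeAt
      (smul_mem_normalConeAt hw (inv_nonneg.2 hpos.le)) h1) h1
    exact ⟨inner ℝ w y, hpos.le, by rw [← this, smul_inv_smul₀ hpos.ne']⟩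
  · rintro _ ⟨t, ht, rfl⟩
    exact smul_mem_normalConeAt (mem_normalConeAt_of_mem_convexPolar hv hyv) ht

/-! ### Exposed points -/

/-- A supporting hyperplane of a strictly convex set touches it in a single point. -/
lemma StrictConvex.exists_inner_lt {C : Set (EuclideanSpace ℝ (Fin m))} (hC : StrictConvex ℝ C)
    {v : EuclideanSpace ℝ (Fin m)} (hv : v ∈ C) (hvf : v ∈ frontier C) :
    ∃ y : EuclideanSpace ℝ (Fin m), ∀ c ∈ C, c ≠ v → inner ℝ y c < inner ℝ y v := by
  obtain ⟨f, hf⟩ := geometric_hahn_banach_open_point hC.convex.interior isOpen_interior hvf.2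
  refine ⟨(InnerProductSpace.toDual ℝ _).symm f, fun c hc hcv => ?_⟩
  rw [InnerProductSpace.toDual_symm_apply, InnerProductSpace.toDual_symm_apply]
  -- The midpoint of `c` and `v` is interior to `C`.
  have := hf _ (hC hc hv hcv (a := 1 / 2) (b := 1 / 2) (by norm_num) (by norm_num) (by norm_num))
  rw [map_add, map_smul, map_smul, smul_eq_mul, smul_eq_mul] at this
  linarith

/-- If a linear form on a compact convex set `L` is larger at `v` than at all other extreme
points, then `v` is the only maximizer of the form on `L`. -/
lemma eq_of_forall_extremePoints_inner_lt {L : Set (EuclideanSpace ℝ (Fin m))}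
    (hL : IsCompact L) (hLc : Convex ℝ L) {v y : EuclideanSpace ℝ (Fin m)}
    (hy : ∀ c ∈ L.extremePoints ℝ, c ≠ v → inner ℝ y c < inner ℝ y v) (hv : v ∈ L) :
    ∀ w ∈ L, inner ℝ y w ≤ inner ℝ y v ∧ (inner ℝ y w = inner ℝ y v → w = v) := by
  set F : Set (EuclideanSpace ℝ (Fin m)) := {x ∈ L | ∀ z ∈ L, innerSL ℝ y z ≤ innerSL ℝ y x}
    with hF
  have hFexp : IsExposed ℝ L F := fun _ => ⟨innerSL ℝ y, rfl⟩
  have hFc : IsCompact F := hFexp.isCompact hL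
  have hFne : F.Nonempty := by
    obtain ⟨x, hx, hmax⟩ := hL.exists_isMaxOn ⟨v, hv⟩ (innerSL ℝ y).continuous.continuousOn
    exact ⟨x, hx, fun z hz => hmax hz⟩
  have hFext : F.extremePoints ℝ ⊆ {v} := fun c hc => by
    by_contra hcv
    have h1 := hy c (hFexp.isExtreme.extremePoints_subset_extremePoints hc) hcv
    have h2 : inner ℝ y v ≤ inner ℝ y c := hc.1.2 v hv
    linarith
  have hFv : F ⊆ {v} := by
    rw [← closure_convexHull_extremePoints hFc (hFexp.convex hLc)]
    calc closure (convexHull ℝ (F.extremePoints ℝ)) ⊆ closure (convexHull ℝ {v}) :=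
          closure_mono (convexHull_mono hFext)
      _ = {v} := by simp
  have hvF : v ∈ F := by
    obtain ⟨x, hx⟩ := hFne
    rw [← hFv hx]
    exact hx
  intro w hw
  refine ⟨hvF.2 w hw, fun h => hFv ⟨hw, fun z hz => ?_⟩⟩
  have : inner ℝ y z ≤ inner ℝ y v := hvF.2 z hz
  rw [← h] at this
  exact this

lemma isProperConvexSubset_of_isCompact (hm : 1 ≤ m) (hKconv : Convex ℝ K) (hKcomp : IsCompact K)
    (hK0 : 0 ∈ interior K) : IsProperConvexSubset K := by
  have : Nonempty (Fin m) := ⟨⟨0, hm⟩⟩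
  obtain ⟨w, hw⟩ := exists_ne (0 : EuclideanSpace ℝ (Fin m))
  refine ⟨hKconv, ⟨0, hK0⟩, {x ∈ K | ∀ z ∈ K, innerSL ℝ w z ≤ innerSL ℝ w x},
    fun _ => ⟨innerSL ℝ w, rfl⟩, ?_, fun h => ?_⟩
  · obtain ⟨x, hx, hmax⟩ := hKcomp.exists_isMaxOn ⟨0, interior_subset hK0⟩
      (innerSL ℝ w).continuous.continuousOn
    exact Set.Nonempty.ne_empty ⟨x, hx, fun z hz => hmax hz⟩
  · have h0 : (0 : EuclideanSpace ℝ (Fin m)) ∈ K := interior_subset hK0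
    rw [← h] at h0
    obtain ⟨y, hy, hpos⟩ := exists_mem_inner_pos hK0 hw
    have h1 : inner ℝ w y ≤ inner ℝ w 0 := h0.2 y hy
    rw [inner_zero_right] at h1
    linarith

theorem mem_classCPrime_of_extremePointsOnStrictlyConvexBoundary (hm : 1 ≤ m)
    (hKconv : Convex ℝ K) (hKcomp : IsCompact K) (hK0 : 0 ∈ interior K)
    (h : ExtremePointsOnStrictlyConvexBoundary (convexPolar K)) : K ∈ classCPrime m := by
  refine ⟨isProperConvexSubset_of_isCompact hm hKconv hKcomp hK0, ?_⟩
  rintro N ⟨rfl | ⟨x, hx, rfl⟩, hne, -⟩ R hR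
  · exact absurd rfl hne
  obtain ⟨v₀, hv₀, rfl⟩ := hR.exists_eq hK0
  have hpos : 0 < inner ℝ v₀ x :=
    inner_pos_of_mem_normalConeAt hK0 (hR.1.2.1 ⟨1, zero_le_one, by simp⟩) hv₀
  obtain ⟨v, hv1, hvR⟩ : ∃ v : EuclideanSpace ℝ (Fin m), inner ℝ v x = 1 ∧
      {w | ∃ t : ℝ, 0 ≤ t ∧ w = t • v₀} = {w | ∃ t : ℝ, 0 ≤ t ∧ w = t • v} := by
    refine ⟨(inner ℝ v₀ x)⁻¹ • v₀, ?_, ?_⟩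
    · rw [real_inner_smul_left, inv_mul_cancel₀ hpos.ne']
    · ext w
      constructor
      · rintro ⟨t, ht, rfl⟩
        exact ⟨t * inner ℝ v₀ x, by positivity, by rw [smul_smul, mul_assoc,
          mul_inv_cancel₀ hpos.ne', mul_one]⟩
      · rintro ⟨t, ht, rfl⟩
        exact ⟨t * (inner ℝ v₀ x)⁻¹, by positivity, by rw [smul_smul]⟩
  rw [hvR] at hR ⊢
  have hvext := mem_extremePoints_convexPolar hx hv1 hR.1.2
  obtain ⟨C, hC, -, hsub⟩ := h
  obtain ⟨y, hy⟩ := hC.exists_inner_lt (hsub hvext).1 (hsub hvext).2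
  have hmax := eq_of_forall_extremePoints_inner_lt (isCompact_convexPolar hK0)
    (convex_convexPolar K) (fun c hc => hy c (hsub hc).1) hvext.1
  have h0L : (0 : EuclideanSpace ℝ (Fin m)) ∈ convexPolar K := fun z _ => by simp
  have hv0 : v ≠ 0 := by
    rintro rfl
    simp at hv1
  -- As `0` belongs to the polar and differs from the only maximizer `v`, the maximum is positive.
  have hyv : 0 < inner ℝ y v := by
    refine lt_of_le_of_ne (by simpa using (hmax 0 h0L).1) fun h0 => hv0 ?_
    exact ((hmax 0 h0L).2 (by rw [inner_zero_right, h0])).symm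
  refine Or.inr ⟨(inner ℝ y v)⁻¹ • y, ?_, normalConeAt_eq_ray hK0 hvext.1 ?_ fun w hw hw1 => ?_⟩
  · rw [← convexPolar_convexPolar hKconv hKcomp.isClosed (interior_subset hK0)]
    intro w hw
    rw [real_inner_smul_left, inv_mul_le_iff₀ hyv, mul_one]
    exact (hmax w hw).1
  · rw [real_inner_smul_right, real_inner_comm y v, inv_mul_cancel₀ hyv.ne']
  · rw [real_inner_smul_right, inv_mul_eq_one₀ hyv.ne', real_inner_comm y w] at hw1
    exact (hmax w hw).2 hw1.symm

/-! ### Coorbitopes -/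

variable {G : Type u} [Group G]

/-- The intersection of the ellipsoids `{x | ‖ρ(g) x‖ ≤ r}` over all `g`: the closed ball of
radius `r` for the invariant norm `sup_g ‖ρ(g) x‖`. -/
def orbitBall (ρ : Representation ℝ G (EuclideanSpace ℝ (Fin m))) (r : ℝ) :
    Set (EuclideanSpace ℝ (Fin m)) :=
  {x | ∀ g, ‖ρ g x‖ ≤ r}

variable {ρ : Representation ℝ G (EuclideanSpace ℝ (Fin m))}

lemma notMem_interior_orbitBall {r : ℝ} (hr : 0 < r) {x : EuclideanSpace ℝ (Fin m)} {g : G}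
    (hx : ‖ρ g x‖ = r) : x ∉ interior (orbitBall ρ r) := by
  intro hmem
  have hc : Filter.Tendsto (fun t : ℝ => t • x) (nhdsWithin 1 (Set.Ioi 1)) (nhds x) := by
    have : Continuous fun t : ℝ => t • x := by fun_prop
    simpa using (this.tendsto 1).mono_left nhdsWithin_le_nhds
  obtain ⟨t, h1, h2⟩ := ((hc.eventually (mem_interior_iff_mem_nhds.1 hmem)).and
    self_mem_nhdsWithin).exists
  have ht : 1 < t := h2
  have := h1 g
  rw [map_smul, norm_smul, hx, Real.norm_of_nonneg (by linarith)] at this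
  nlinarith

variable [TopologicalSpace G] [CompactSpace G]

lemma mem_interior_orbitBall
    (hρ : Continuous fun p : G × EuclideanSpace ℝ (Fin m) => ρ p.1 p.2) {r : ℝ}
    {x : EuclideanSpace ℝ (Fin m)} (hx : ∀ g, ‖ρ g x‖ < r) : x ∈ interior (orbitBall ρ r) := by
  -- The exceptional set is a projection of a closed set along the compact group.
  have hcl : IsClosed (Prod.snd '' {p : G × EuclideanSpace ℝ (Fin m) | r ≤ ‖ρ p.1 p.2‖}) :=
    isClosedMap_snd_of_compactSpace _ (isClosed_le continuous_const hρ.norm)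
  refine mem_interior.2 ⟨_, fun z hz g => ?_, hcl.isOpen_compl, ?_⟩
  · by_contra! hlt
    exact hz ⟨(g, z), hlt.le, rfl⟩
  · rintro ⟨⟨g, _⟩, hg, rfl⟩
    exact absurd (hx g) (not_lt.2 hg)

lemma strictConvex_orbitBall
    (hρ : Continuous fun p : G × EuclideanSpace ℝ (Fin m) => ρ p.1 p.2) {r : ℝ} (hr : 0 < r) :
    StrictConvex ℝ (orbitBall ρ r) := by
  intro x hx y hy hxy a b ha hb hab
  refine mem_interior_orbitBall hρ fun g => ?_
  have hne : ρ g x ≠ ρ g y := (ρ.apply_bijective g).injective.ne hxy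
  have := strictConvex_closedBall ℝ (0 : EuclideanSpace ℝ (Fin m)) r
    (mem_closedBall_zero_iff.2 (hx g)) (mem_closedBall_zero_iff.2 (hy g)) hne ha hb hab
  rw [interior_closedBall _ hr.ne', mem_ball_zero_iff] at this
  rwa [map_add, map_smul, map_smul]

/-- The orbit of a nonzero point lies on the boundary of a strictly convex set with interior
points. -/
lemma exists_strictConvex_range_subset_frontier
    (hρ : Continuous fun p : G × EuclideanSpace ℝ (Fin m) => ρ p.1 p.2)
    {v : EuclideanSpace ℝ (Fin m)} (hv : v ≠ 0) :
    ∃ C : Set (EuclideanSpace ℝ (Fin m)), StrictConvex ℝ C ∧ (interior C).Nonempty ∧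
      Set.range (fun g : G => ρ g v) ⊆ C ∩ frontier C := by
  obtain ⟨g₀, -, hg₀⟩ := isCompact_univ.exists_isMaxOn (⟨1, trivial⟩ : (Set.univ : Set G).Nonempty)
    (f := fun g : G => ‖ρ g v‖) (hρ.comp (continuous_id.prodMk continuous_const)).norm.continuousOn
  have hr : 0 < ‖ρ g₀ v‖ := by
    rw [norm_pos_iff]
    intro h
    exact hv ((ρ.apply_bijective g₀).injective (by rw [h, map_zero]))
  refine ⟨orbitBall ρ ‖ρ g₀ v‖, strictConvex_orbitBall hρ hr,
    ⟨0, mem_interior_orbitBall hρ fun g => by rwa [map_zero, norm_zero]⟩, ?_⟩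
  rintro _ ⟨h, rfl⟩
  have hmem : ρ h v ∈ orbitBall ρ ‖ρ g₀ v‖ := fun g => by
    rw [← Module.End.mul_apply, ← map_mul]
    exact hg₀ (Set.mem_univ (g * h))
  refine ⟨hmem, subset_closure hmem, notMem_interior_orbitBall (g := g₀ * h⁻¹) hr ?_⟩
  rw [← Module.End.mul_apply, ← map_mul, inv_mul_cancel_right]

/-- By Carathéodory's theorem, the convex hull is the union, over `n ≤ dim E + 1`, of the images of
the compact sets `Δ × A ^ n` under `(w, z) ↦ ∑ i, w i • z i`, where `Δ` is the standard simplex. -/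
lemma isCompact_convexHull_of_isCompact {E : Type*} [NormedAddCommGroup E] [NormedSpace ℝ E]
    [FiniteDimensional ℝ E] {A : Set E} (hA : IsCompact A) : IsCompact (convexHull ℝ A) := by
  have heq : convexHull ℝ A = ⋃ n ∈ Set.Iic (Module.finrank ℝ E + 1),
      (fun p : (Fin n → ℝ) × (Fin n → E) => ∑ i, p.1 i • p.2 i) ''
        (stdSimplex ℝ (Fin n) ×ˢ Set.univ.pi fun _ => A) := by
    refine Set.Subset.antisymm (fun x hx => ?_) ?_
    · obtain ⟨ι, _, z, w, hz, hind, hw, hw1, rfl⟩ := eq_pos_convex_span_of_mem_convexHull hx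
      have hcard : Fintype.card ι ≤ Module.finrank ℝ E + 1 :=
        hind.card_le_finrank_succ.trans (Nat.succ_le_succ (Submodule.finrank_le _))
      let e := (Fintype.equivFin ι).symm
      refine Set.mem_biUnion (x := Fintype.card ι) hcard
        ⟨(w ∘ e, z ∘ e), ⟨⟨fun i => (hw _).le, ?_⟩, fun i _ => hz ⟨_, rfl⟩⟩, ?_⟩
      · exact (e.sum_comp w).trans hw1
      · exact e.sum_comp fun i => w i • z i
    · refine Set.iUnion₂_subset fun n _ => ?_
      rintro _ ⟨⟨w, z⟩, ⟨hw, hz⟩, rfl⟩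
      exact (convex_convexHull ℝ A).sum_mem (fun i _ => hw.1 i) hw.2
        fun i _ => subset_convexHull ℝ A (hz i trivial)
  rw [heq]
  refine (Set.finite_Iic _).isCompact_biUnion fun n _ => ?_
  exact ((isCompact_stdSimplex ℝ (Fin n)).prod (isCompact_univ_pi fun _ => hA)).image (by fun_prop)

/-- A nonempty closed convex set whose polar is bounded contains the origin and equals its bipolar. -/
lemma convexPolar_convexPolar_of_isBounded {O : Set (EuclideanSpace ℝ (Fin m))}
    (hO : Convex ℝ O) (hOcl : IsClosed O) (hb : Bornology.IsBounded (convexPolar O))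
    (hne : O.Nonempty) : convexPolar (convexPolar O) = O := by
  refine convexPolar_convexPolar hO hOcl ?_
  by_contra h0
  obtain ⟨w, u, h1, h2⟩ := exists_inner_lt_of_notMem hO hOcl h0
  rw [inner_zero_right] at h2
  -- The polar contains the whole ray spanned by the separating vector `w`.
  obtain ⟨B, hB⟩ := hb.exists_norm_le
  have hw0 : w ≠ 0 := by
    rintro rfl
    obtain ⟨x, hx⟩ := hne
    have := h1 x hx
    rw [inner_zero_left] at this
    linarith
  have hwn : 0 < ‖w‖ := norm_pos_iff.2 hw0
  have ht : 0 ≤ (|B| + 1) / ‖w‖ := by positivity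
  have := hB (((|B| + 1) / ‖w‖) • w) fun x hx => by
    rw [real_inner_smul_left]
    have := mul_nonpos_of_nonneg_of_nonpos ht ((h1 x hx).trans h2).le
    linarith
  rw [norm_smul, Real.norm_of_nonneg ht, div_mul_cancel₀ _ hwn.ne'] at this
  linarith [le_abs_self B]

theorem IsCoorbitope.extremePointsOnStrictlyConvexBoundary (hm : 1 ≤ m) (hKcomp : IsCompact K)
    (hK : IsCoorbitope.{u} K) : ExtremePointsOnStrictlyConvexBoundary (convexPolar K) := by
  obtain ⟨O, ⟨G, _, _, _, _, ρ, hρ, v, rfl⟩, rfl⟩ := hK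
  have hv : v ≠ 0 := by
    rintro rfl
    -- The polar of the orbitope `{0}` is the whole space, which is not compact.
    have hu : convexPolar (convexHull ℝ (Set.range fun g : G =>
        ρ g (0 : EuclideanSpace ℝ (Fin m)))) = Set.univ := by
      refine Set.eq_univ_of_forall fun w x hx => ?_
      simp only [map_zero, Set.range_const, convexHull_singleton, Set.mem_singleton_iff] at hx
      rw [hx, inner_zero_right]
      exact zero_le_one
    have : Nonempty (Fin m) := ⟨⟨0, hm⟩⟩
    rw [hu] at hKcomp
    exact noncompact_univ (EuclideanSpace ℝ (Fin m)) hKcomp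
  have hcomp : IsCompact (Set.range fun g : G => ρ g v) :=
    isCompact_range (hρ.comp (continuous_id.prodMk continuous_const))
  obtain ⟨C, hC, hCi, hsub⟩ := exists_strictConvex_range_subset_frontier hρ hv
  refine ⟨C, hC, hCi, ?_⟩
  rw [convexPolar_convexPolar_of_isBounded (convex_convexHull ℝ _)
    (isCompact_convexHull_of_isCompact hcomp).isClosed hKcomp.isBounded
    ⟨_, subset_convexHull ℝ _ ⟨1, rfl⟩⟩]
  exact extremePoints_convexHull_subset.trans hsub

end Polarity

theorem mainTheorem9 (m : ℕ) (hm : 1 ≤ m) (K : Set (EuclideanSpace ℝ (Fin m)))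
    (hKconv : Convex ℝ K) (hKcomp : IsCompact K) (hK0 : (0 : EuclideanSpace ℝ (Fin m)) ∈ interior K) :
    (ExtremePointsOnStrictlyConvexBoundary (convexPolar K) → K ∈ classCPrime m) ∧
      (IsCoorbitope.{u} K →
        ExtremePointsOnStrictlyConvexBoundary (convexPolar K) ∧ K ∈ classCPrime m) := by
  have h := mem_classCPrime_of_extremePointsOnStrictlyConvexBoundary hm hKconv hKcomp hK0
  refine ⟨h, fun hK => ?_⟩
  have hext := hK.extremePointsOnStrictlyConvexBoundary hm hKcomp
  exact ⟨hext, h hext⟩
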